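/- Let $(X,d)$ be a metric space, $M\subseteq X$ a closed subset and $K>0$. A $K$-gentle partition of unity with respect to $M$ consists of a measure space $(\Omega,\Sigma,\mathbb P)$, a function $\Psi:\Omega\times X\to[0,\infty)$ and a measurable map $\gamma:\Omega\to M$ such that (i) $\Psi(\cdot,x)\equiv 0$ for all $x\in M$; (ii) for all $x\in X\setminus M$ the function $\Psi(\cdot,x)$ is measurable and $\int_\Omega\Psi(\omega,x)\,d\mathbb P(\omega)=1$; (iii) $\int_\Omega d(\gamma(\omega),x)\,|\Psi(\omega,x)-\Psi(\omega,y)|\,d\mathbb P(\omega)\le K\,d(x,y)$ for all $x,y\in X$. For $K\ge 1$, a strong $K$-random projection on $M$ is a family $\{\upsilon_x\}_{x\in X}$ of Borel probability measures on $M$ with finite first moment such that $\upsilon_x=\delta_x$ for $x\in M$ and $W_1(\upsilon_x,\upsilon_y)\le K\,d(x,y)$ for all $x,y\in X$, where $W_1(\mu,\eta)=\inf_\pi\int_{M\times M} d(z,z')\,d\pi(z,z')$, the infimum being over all measures $\pi$ on $M\times M$ with marginals $\mu$ and $\eta$. The doubling constant $\lambda(X)$ is the infimum of all natural numbers $n$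 such that every ball in $X$ can be covered by $n$ balls of half the radius; $X$ is doubling if $\lambda(X)<\infty$. **Theorem.** (1) Let $(X,d)$ be a Polish metric space, $M\subseteq X$ closed and $K\ge1$. If $(\Psi,\gamma)$ is a $K$-gentle partition of unity with respect to $M$, over a measure space $(\Omega,\Sigma,\mathbb P)$, then the measures on $M$ given by $$\upsilon_x:=\delta_x\ \text{ if } x\in M,\qquad \upsilon_x:=\gamma_\#\big(\Psi(\cdot,x)\,\mathbb P\big),\ \text{ i.e. } \upsilon_x(A)=\int_{\gamma^{-1}(A)}\Psi(\omega,x)\,d\mathbb P(\omega),\ \text{ if } x\in X\setminus M,$$ are Borel probability measures on $M$ with finite first moment, and $\{\upsilon_x\}_{x\in X}$ is a strong $K$-random projection on $M$. (2) There is a universal constant $C>0$ such that for every doubling Polish metric space $(X,d)$ with at least two points and every nonempty closed $M\subseteq X$ we have $C\log\lambda(X)\ge 1$, and there exists a strong $C\log\lambda(X)$-random projection on $M$. -/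

import Mathlib

open MeasureTheory
open scoped ENNReal

/-- `(Ψ, γ)` is a `K`-gentle partition of unity of `X` with respect to `M`, over the measure
space `(Ω, P)`. The integrands are nonnegative, so the integrals are Lebesgue integrals with
values in `[0, ∞]`. -/
structure IsGentlePartitionOfUnity {X Ω : Type*} [MetricSpace X] [MeasurableSpace X]
    [MeasurableSpace Ω] (P : Measure Ω) (K : ℝ) (M : Set X) (Ψ : Ω → X → ℝ) (γ : Ω → M) :
    Prop where
  K_pos : 0 < K
  nonneg : ∀ ω x, 0 ≤ Ψ ω x
  eq_zero : ∀ x ∈ M, ∀ ω, Ψ ω x = 0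
  measurable : ∀ x ∉ M, Measurable fun ω => Ψ ω x
  lintegral_eq_one : ∀ x ∉ M, ∫⁻ ω, ENNReal.ofReal (Ψ ω x) ∂P = 1
  measurable_gamma : Measurable γ
  gentle : ∀ x y : X,
    ∫⁻ ω, ENNReal.ofReal (dist (γ ω : X) x * |Ψ ω x - Ψ ω y|) ∂P ≤ ENNReal.ofReal (K * dist x y)

/-- The class `𝒫₁(Y)`: probability measures with finite first moment. -/
def HasFiniteFirstMoment {Y : Type*} [MetricSpace Y] [MeasurableSpace Y] (μ : Measure Y) : Prop :=
  IsProbabilityMeasure μ ∧ ∀ y₀ : Y, ∫⁻ y, edist y y₀ ∂μ < ∞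

/-- The Wasserstein (Kantorovich-Rubinstein) distance of order one: the infimum of the transport
cost over all measures on `Y × Y` with marginals `μ` and `η`. -/
noncomputable def wasserstein₁ {Y : Type*} [MetricSpace Y] [MeasurableSpace Y]
    (μ η : Measure Y) : ℝ≥0∞ :=
  ⨅ (π : Measure (Y × Y)) (_ : π.map Prod.fst = μ ∧ π.map Prod.snd = η),
    ∫⁻ p, edist p.1 p.2 ∂π

/-- `υ` is a strong `K`-random projection of `X` on `M`. -/
structure IsStrongRandomProjection {X : Type*} [MetricSpace X] [MeasurableSpace X]
    (K : ℝ) (M : Set X) (υ : X → Measure M) : Prop where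
  one_le : 1 ≤ K
  finite_first_moment : ∀ x, HasFiniteFirstMoment (υ x)
  eq_dirac : ∀ x : M, υ x = Measure.dirac x
  wasserstein_le : ∀ x y : X, wasserstein₁ (υ x) (υ y) ≤ ENNReal.ofReal (K * dist x y)

open Classical in
/-- The family of measures induced by `(Ψ, γ)`: the Dirac mass at `x` if `x ∈ M`, and the
pushforward under `γ` of the measure with density `Ψ(·, x)` with respect to `P` otherwise. -/
noncomputable def inducedMeasure {X Ω : Type*} [MeasurableSpace X] [MeasurableSpace Ω]
    (P : Measure Ω) (M : Set X) (Ψ : Ω → X → ℝ) (γ : Ω → M) (x : X) : Measure M :=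
  if hx : x ∈ M then Measure.dirac ⟨x, hx⟩
  else (P.withDensity fun ω => ENNReal.ofReal (Ψ ω x)).map γ

/-- Every ball in `X` can be covered by `n` balls of half the radius. -/
def BallsCoveredBy (X : Type*) [MetricSpace X] (n : ℕ) : Prop :=
  ∀ (x : X) (r : ℝ), 0 < r →
    ∃ t : Finset X, t.card ≤ n ∧ Metric.ball x r ⊆ ⋃ c ∈ t, Metric.ball c (r / 2)

/-- The doubling constant `λ(X)`, equal to `⊤` if `X` is not doubling. -/
noncomputable def doublingConstant (X : Type*) [MetricSpace X] : ℕ∞ :=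
  ⨅ (n : ℕ) (_ : BallsCoveredBy X n), (n : ℕ∞)

/-! (1) Off `M`, couple the two induced measures by leaving the common density `min (Ψ(·,x),
Ψ(·,y))` in place and coupling the two excesses independently. Routing the excess through the point
`x` costs at most `∫ d(γ,x) |Ψ(·,x) - Ψ(·,y)|`, which is the gentleness integral. If `y ∈ M`, then
`Ψ(·,y) = 0`, and gentleness bounds the first moment about `y`, which is the cost of transport to
`δ_y`.

(2) By (1) it suffices to build a gentle partition of unity with constant of order `log λ`. At each
scale `s = exp n`, take a maximal `s`-separated net of `M` and give its points weights proportional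
to `exp (-β d(x,z) / s)`. The logarithm of such a weight is `2β/s`-Lipschitz in `x`. Doubling lets
the number of net points grow by a factor `λ` per doubling of the radius, so with `β` of order `log
λ` the mass sits within `O(s)` of `x` when `d(x,M) = O(s)`. Distance `O(s)` times relative change
`O(β d(x,y)/s)` gives `O(β) d(x,y)`. Tent functions of `log d(x,M)` select the scales comparable to
`d(x,M)`, and their variation adds only `O(d(x,y))`. -/

/-! ### Couplings and the measures induced by a gentle partition of unity -/

theorem wasserstein₁_map_withDensity_le {X Ω : Type*} [MetricSpace X] [SecondCountableTopology X]
    [MeasurableSpace X] [BorelSpace X] [MeasurableSpace Ω] {M : Set X} {P : Measure Ω}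
    {f g : Ω → ℝ≥0∞} {γ : Ω → M} (hγ : Measurable γ) (hf : Measurable f) (hg : Measurable g)
    (hf1 : ∫⁻ ω, f ω ∂P = 1) (hg1 : ∫⁻ ω, g ω ∂P = 1) (x : X) :
    wasserstein₁ ((P.withDensity f).map γ) ((P.withDensity g).map γ) ≤
      ∫⁻ ω, edist (γ ω : X) x * ((f ω - g ω) + (g ω - f ω)) ∂P := by
  set m : Ω → ℝ≥0∞ := fun ω => min (f ω) (g ω)
  set a : Ω → ℝ≥0∞ := fun ω => f ω - g ω with ha_def
  set b : Ω → ℝ≥0∞ := fun ω => g ω - f ω with hb_def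
  have hm : Measurable m := hf.min hg
  have ha : Measurable a := hf.sub hg
  have hb : Measurable b := hg.sub hf
  have hma : f = m + a := by
    funext ω
    rcases le_total (f ω) (g ω) with h | h
    · simp [m, a, h, tsub_eq_zero_of_le h]
    · simp [m, a, h, add_tsub_cancel_of_le h]
  have hmb : g = m + b := by
    funext ω
    rcases le_total (f ω) (g ω) with h | h
    · simp [m, b, h, add_tsub_cancel_of_le h]
    · simp [m, b, h, tsub_eq_zero_of_le h]
  have hIa : ∫⁻ ω, m ω ∂P + ∫⁻ ω, a ω ∂P = 1 := by
    rw [← lintegral_add_left hm, ← hf1, hma]; rfl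
  have hIb : ∫⁻ ω, m ω ∂P + ∫⁻ ω, b ω ∂P = 1 := by
    rw [← lintegral_add_left hm, ← hg1, hmb]; rfl
  have hm_fin : ∫⁻ ω, m ω ∂P ≠ ∞ := ne_top_of_le_ne_top ENNReal.one_ne_top (hIa ▸ le_self_add)
  have hab : ∫⁻ ω, b ω ∂P = ∫⁻ ω, a ω ∂P :=
    (ENNReal.add_right_inj hm_fin).1 (hIb.trans hIa.symm)
  set s := ∫⁻ ω, a ω ∂P with hs
  have hs_fin : s ≠ ∞ := ne_top_of_le_ne_top ENNReal.one_ne_top (hIa ▸ le_add_self)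
  set α := (P.withDensity a).map γ with hα
  set β := (P.withDensity b).map γ with hβ
  have hαu : α Set.univ = s := by simp [hα, Measure.map_apply hγ MeasurableSet.univ, hs]
  have hβu : β Set.univ = s := by simp [hβ, Measure.map_apply hγ MeasurableSet.univ, hab]
  have : IsFiniteMeasure α := ⟨by rw [hαu]; exact hs_fin.lt_top⟩
  have : IsFiniteMeasure β := ⟨by rw [hβu]; exact hs_fin.lt_top⟩
  -- For `s = 0` the factor `s⁻¹` is `∞`, but then `ν = 0` and the identity survives.
  have hsc : ∀ ν : Measure M, ν Set.univ = s → s⁻¹ • s • ν = ν := by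
    intro ν hν
    by_cases h0 : s = 0
    · rw [h0, Measure.measure_univ_eq_zero] at hν
      simp [hν]
    · rw [smul_smul, ENNReal.inv_mul_cancel h0 hs_fin, one_smul]
  have hγ2 : Measurable fun ω => (γ ω, γ ω) := hγ.prodMk hγ
  -- The common part sits on the diagonal at no cost; the excesses, both of mass `s`, are coupled by
  -- their normalised product.
  set π := (P.withDensity m).map (fun ω => (γ ω, γ ω)) + s⁻¹ • α.prod β with hπ
  have hfst : π.map Prod.fst = (P.withDensity f).map γ := by
    rw [hπ, Measure.map_add _ _ measurable_fst, Measure.map_map measurable_fst hγ2,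
      Measure.map_smul, Measure.map_fst_prod, hβu, hsc α hαu, hma, withDensity_add_left hm,
      Measure.map_add _ _ hγ]
    rfl
  have hsnd : π.map Prod.snd = (P.withDensity g).map γ := by
    rw [hπ, Measure.map_add _ _ measurable_snd, Measure.map_map measurable_snd hγ2,
      Measure.map_smul, Measure.map_snd_prod, hαu, hsc β hβu, hmb, withDensity_add_left hm,
      Measure.map_add _ _ hγ]
    rfl
  refine (iInf₂_le π ⟨hfst, hsnd⟩).trans ?_
  have he : Measurable fun z : M => edist (z : X) x := measurable_subtype_coe.edist measurable_const
  have he2 : Measurable fun p : M × M => edist p.1 p.2 := measurable_fst.edist measurable_snd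
  have key : ∀ h : Ω → ℝ≥0∞, Measurable h →
      ∫⁻ z, edist (z : X) x ∂((P.withDensity h).map γ) = ∫⁻ ω, edist (γ ω : X) x * h ω ∂P := by
    intro h hh
    rw [lintegral_map he hγ]
    refine (lintegral_withDensity_eq_lintegral_mul _ hh (he.comp hγ)).trans ?_
    simp [mul_comm]
  have hcross : ∫⁻ p, edist p.1 p.2 ∂(α.prod β) ≤
      s * (∫⁻ z, edist (z : X) x ∂α + ∫⁻ z, edist (z : X) x ∂β) := by
    calc ∫⁻ p, edist p.1 p.2 ∂(α.prod β)
        ≤ ∫⁻ p, (edist (p.1 : X) x + edist (p.2 : X) x) ∂(α.prod β) :=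
          lintegral_mono fun p => edist_triangle_right _ _ _
      _ = ∫⁻ u, ∫⁻ v, (edist (u : X) x + edist (v : X) x) ∂β ∂α :=
          lintegral_prod _ ((he.comp measurable_fst).add (he.comp measurable_snd)).aemeasurable
      _ = ∫⁻ u, (edist (u : X) x * s + ∫⁻ v, edist (v : X) x ∂β) ∂α := by
          refine lintegral_congr fun u => ?_
          rw [lintegral_add_left measurable_const, lintegral_const, hβu]
      _ = s * (∫⁻ z, edist (z : X) x ∂α + ∫⁻ z, edist (z : X) x ∂β) := by
          rw [lintegral_add_right _ measurable_const, lintegral_const, hαu, lintegral_mul_const _ he]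
          ring
  rw [hπ, lintegral_add_measure, lintegral_map he2 hγ2, lintegral_smul_measure]
  simp only [edist_self, lintegral_zero, zero_add, smul_eq_mul]
  calc s⁻¹ * ∫⁻ p, edist p.1 p.2 ∂(α.prod β)
      ≤ s⁻¹ * (s * (∫⁻ z, edist (z : X) x ∂α + ∫⁻ z, edist (z : X) x ∂β)) := by gcongr
    _ ≤ ∫⁻ z, edist (z : X) x ∂α + ∫⁻ z, edist (z : X) x ∂β := by
        rw [← mul_assoc]
        exact mul_le_of_le_one_left zero_le (ENNReal.inv_mul_le_one s)
    _ = _ := by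
        rw [hα, hβ, key a ha, key b hb, ← lintegral_add_left]
        · simp only [mul_add, ha_def, hb_def]
        · exact (he.comp hγ).mul ha

theorem wasserstein₁_dirac_le {Y : Type*} [MetricSpace Y] [SecondCountableTopology Y]
    [MeasurableSpace Y] [BorelSpace Y] (y : Y) (η : Measure Y) [IsProbabilityMeasure η] :
    wasserstein₁ (Measure.dirac y) η ≤ ∫⁻ z, edist z y ∂η := by
  refine (iInf₂_le ((Measure.dirac y).prod η) ⟨by simp, by simp⟩).trans ?_
  have he2 : Measurable fun p : Y × Y => edist p.1 p.2 := measurable_fst.edist measurable_snd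
  rw [lintegral_prod _ he2.aemeasurable, lintegral_dirac' _ he2.lintegral_prod_right']
  simp [edist_comm]

theorem wasserstein₁_comm {Y : Type*} [MetricSpace Y] [SecondCountableTopology Y]
    [MeasurableSpace Y] [BorelSpace Y] (μ η : Measure Y) :
    wasserstein₁ μ η = wasserstein₁ η μ := by
  have he2 : Measurable fun p : Y × Y => edist p.1 p.2 := measurable_fst.edist measurable_snd
  have h : ∀ μ η : Measure Y, wasserstein₁ μ η ≤ wasserstein₁ η μ := by
    refine fun μ η => le_iInf₂ fun π hπ => (iInf₂_le (π.map Prod.swap) ?_).trans ?_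
    · refine ⟨?_, ?_⟩
      · rw [Measure.map_map measurable_fst measurable_swap]; exact hπ.2
      · rw [Measure.map_map measurable_snd measurable_swap]; exact hπ.1
    · rw [lintegral_map he2 measurable_swap]
      simp [edist_comm]
  exact le_antisymm (h _ _) (h _ _)

theorem ENNReal.ofReal_sub_add_ofReal_sub (u v : ℝ) (hu : 0 ≤ u) (hv : 0 ≤ v) :
    (ENNReal.ofReal u - ENNReal.ofReal v) + (ENNReal.ofReal v - ENNReal.ofReal u) =
      ENNReal.ofReal |u - v| := by
  rw [← ENNReal.ofReal_sub _ hv, ← ENNReal.ofReal_sub _ hu]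
  rcases le_total u v with h | h
  · rw [ENNReal.ofReal_of_nonpos (sub_nonpos.2 h), zero_add, abs_sub_comm,
      abs_of_nonneg (sub_nonneg.2 h)]
  · rw [ENNReal.ofReal_of_nonpos (sub_nonpos.2 h), add_zero, abs_of_nonneg (sub_nonneg.2 h)]

namespace IsGentlePartitionOfUnity

variable {X Ω : Type*} [MetricSpace X] [MeasurableSpace X] [MeasurableSpace Ω] {P : Measure Ω} {K : ℝ} {M : Set X} {Ψ : Ω → X → ℝ}
  {γ : Ω → M}

theorem isProbabilityMeasure_inducedMeasure (h : IsGentlePartitionOfUnity P K M Ψ γ) (x : X) :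
    IsProbabilityMeasure (inducedMeasure P M Ψ γ x) := by
  unfold inducedMeasure
  split_ifs with hx
  · infer_instance
  · constructor
    rw [Measure.map_apply h.measurable_gamma MeasurableSet.univ]
    simpa using h.lintegral_eq_one x hx

/-- Since `Ψ(·,y) = 0`, this is gentleness for the pair `(y, x)` when `x ∉ M`; for `x ∈ M` it needs
`1 ≤ K`. It yields both the finite first moment and the Wasserstein bound against a Dirac mass. -/
theorem lintegral_edist_inducedMeasure_le [SecondCountableTopology X] [BorelSpace X] (h : IsGentlePartitionOfUnity P K M Ψ γ) (hK : 1 ≤ K) (x : X)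
    (y : M) : ∫⁻ z, edist z y ∂(inducedMeasure P M Ψ γ x) ≤ ENNReal.ofReal (K * dist (y : X) x) := by
  have he : Measurable fun z : M => edist z y :=
    (measurable_subtype_coe.edist measurable_const : Measurable fun z : M => edist (z : X) y)
  unfold inducedMeasure
  split_ifs with hx
  · rw [lintegral_dirac' _ he, edist_dist, dist_comm]
    refine ENNReal.ofReal_le_ofReal ?_
    exact le_mul_of_one_le_left dist_nonneg hK
  · rw [lintegral_map he h.measurable_gamma]
    refine le_trans (le_of_eq ?_) (h.gentle y x)
    refine (lintegral_withDensity_eq_lintegral_mul _ (h.measurable x hx).ennreal_ofReal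
      (he.comp h.measurable_gamma)).trans ?_
    refine lintegral_congr fun ω => ?_
    rw [h.eq_zero y y.2, zero_sub, abs_neg, abs_of_nonneg (h.nonneg _ _),
      ENNReal.ofReal_mul dist_nonneg, Pi.mul_apply, mul_comm, ← edist_dist]
    rfl

theorem isStrongRandomProjection [SecondCountableTopology X] [BorelSpace X] (h : IsGentlePartitionOfUnity P K M Ψ γ) (hK : 1 ≤ K) :
    IsStrongRandomProjection K M (inducedMeasure P M Ψ γ) := by
  have hprob := h.isProbabilityMeasure_inducedMeasure
  refine ⟨hK, fun x => ⟨hprob x, fun y =>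
    (h.lintegral_edist_inducedMeasure_le hK x y).trans_lt ENNReal.ofReal_lt_top⟩,
    fun x => by simp [inducedMeasure], fun x y => ?_⟩
  by_cases hx : x ∈ M
  · have : inducedMeasure P M Ψ γ x = Measure.dirac ⟨x, hx⟩ := by simp [inducedMeasure, hx]
    rw [this]
    exact (wasserstein₁_dirac_le _ _).trans (h.lintegral_edist_inducedMeasure_le hK y ⟨x, hx⟩)
  by_cases hy : y ∈ M
  · have : inducedMeasure P M Ψ γ y = Measure.dirac ⟨y, hy⟩ := by simp [inducedMeasure, hy]
    rw [this, wasserstein₁_comm, dist_comm]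
    exact (wasserstein₁_dirac_le _ _).trans (h.lintegral_edist_inducedMeasure_le hK x ⟨y, hy⟩)
  simp only [inducedMeasure, hx, hy, dite_false]
  refine (wasserstein₁_map_withDensity_le h.measurable_gamma (h.measurable x hx).ennreal_ofReal
    (h.measurable y hy).ennreal_ofReal (h.lintegral_eq_one x hx) (h.lintegral_eq_one y hy) x).trans
    (le_trans (le_of_eq ?_) (h.gentle x y))
  refine lintegral_congr fun ω => ?_
  rw [ENNReal.ofReal_sub_add_ofReal_sub _ _ (h.nonneg _ _) (h.nonneg _ _),
    ENNReal.ofReal_mul dist_nonneg, edist_dist]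

end IsGentlePartitionOfUnity

/-! ### Separated nets in doubling spaces -/

theorem exists_separated_net {X : Type*} [MetricSpace X] (M : Set X) {s : ℝ} (hs : 0 < s) :
    ∃ N ⊆ M, (N.Pairwise fun a b => s ≤ dist a b) ∧ ∀ m ∈ M, ∃ z ∈ N, dist m z < s := by
  obtain ⟨N, hN⟩ := zorn_subset {N : Set X | N ⊆ M ∧ N.Pairwise fun a b => s ≤ dist a b} (by
    refine fun c hc hchain => ⟨⋃₀ c, ⟨Set.sUnion_subset fun N hN => (hc hN).1, ?_⟩,
      fun N hN => Set.subset_sUnion_of_mem hN⟩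
    exact (Set.pairwise_sUnion hchain.directedOn).2 fun N hN => (hc hN).2)
  refine ⟨N, hN.prop.1, hN.prop.2, fun m hm => ?_⟩
  by_contra! h
  have hins : insert m N ∈ {N : Set X | N ⊆ M ∧ N.Pairwise fun a b => s ≤ dist a b} := by
    refine ⟨Set.insert_subset hm hN.prop.1, hN.prop.2.insert fun b hb _ => ⟨h b hb, ?_⟩⟩
    rw [dist_comm]
    exact h b hb
  have hmN : m ∈ N := hN.le_of_ge hins (Set.subset_insert m N) (Set.mem_insert m N)
  have := h m hmN
  rw [dist_self] at this
  exact this.not_gt hs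

theorem BallsCoveredBy.iterate {X : Type*} [MetricSpace X] {L : ℕ} (hL : BallsCoveredBy X L)
    (k : ℕ) (x : X) {r : ℝ} (hr : 0 < r) :
    ∃ t : Finset X, t.card ≤ L ^ k ∧ Metric.ball x r ⊆ ⋃ c ∈ t, Metric.ball c (r / 2 ^ k) := by
  classical
  induction k with
  | zero => exact ⟨{x}, by simp, by simp⟩
  | succ k ih =>
    obtain ⟨t, ht, hcov⟩ := ih
    choose f hf hfcov using fun c : X => hL c (r / 2 ^ k) (by positivity)
    refine ⟨t.biUnion f, ?_, fun y hy => ?_⟩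
    · refine (Finset.card_biUnion_le_card_mul _ _ _ fun c _ => hf c).trans ?_
      rw [pow_succ]
      gcongr
    · obtain ⟨c, hc, hyc⟩ := Set.mem_iUnion₂.1 (hcov hy)
      obtain ⟨c', hc', hyc'⟩ := Set.mem_iUnion₂.1 (hfcov c hyc)
      refine Set.mem_iUnion₂.2 ⟨c', Finset.mem_biUnion.2 ⟨c, hc, hc'⟩, ?_⟩
      rwa [pow_succ, ← div_div]

open Classical in
-- After `k + 1` halvings the covering balls have radius `s / 2`, so each holds at most one point of
-- an `s`-separated set.
theorem BallsCoveredBy.tsum_indicator_le {X : Type*} [MetricSpace X] {L : ℕ}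
    (hL : BallsCoveredBy X L) {N : Set X} {s : ℝ} (hs : 0 < s)
    (hN : N.Pairwise fun a b => s ≤ dist a b) (x : X) (k : ℕ) :
    ∑' z : N, (if dist x z < 2 ^ k * s then 1 else 0 : ℝ≥0∞) ≤ (L : ℝ≥0∞) ^ (k + 1) := by
  obtain ⟨t, ht, hcov⟩ := hL.iterate (k + 1) x (r := 2 ^ k * s) (by positivity)
  rw [ENNReal.tsum_eq_iSup_sum]
  refine iSup_le fun F => ?_
  rw [Finset.sum_boole]
  have hcard : (F.filter fun z : N => dist x z < 2 ^ k * s).card ≤ t.card := by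
    refine Finset.card_le_card_of_forall_subsingleton
      (fun (z : N) c => dist (z : X) c < s / 2) (fun z hz => ?_) (fun c _ z hz z' hz' => ?_)
    · have hz' : (z : X) ∈ Metric.ball x (2 ^ k * s) := by
        rw [Metric.mem_ball, dist_comm]
        exact (Finset.mem_filter.1 hz).2
      obtain ⟨c, hc, hzc⟩ := Set.mem_iUnion₂.1 (hcov hz')
      refine ⟨c, hc, (Metric.mem_ball.1 hzc).trans_eq ?_⟩
      rw [pow_succ]
      field_simp
    · by_contra hne
      have h1 := hN z.2 z'.2 fun h => hne (Subtype.ext h)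
      have h2 := dist_triangle_right (z : X) z' c
      have h3 := hz.2
      have h4 := hz'.2
      linarith
  exact_mod_cast hcard.trans ht

/-- Sorting the points into dyadic balls bounds the sum by `∑ exp(-α)^k L^(k+1)`, a geometric series
of ratio at most `1/2`. -/
theorem BallsCoveredBy.tsum_exp_le {X : Type*} [MetricSpace X] {L : ℕ}
    (hL : BallsCoveredBy X L) {N : Set X} {s : ℝ} (hs : 0 < s)
    (hN : N.Pairwise fun a b => s ≤ dist a b) {α : ℝ} (hα0 : 0 ≤ α)
    (hα : Real.exp (-α) * (2 * L) ≤ 1) (x : X) :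
    ∑' z : N, ENNReal.ofReal (Real.exp (-(α * dist x z / s))) ≤ 2 * L := by
  classical
  have hpt : ∀ z : N, ENNReal.ofReal (Real.exp (-(α * dist x z / s))) ≤
      ∑' k : ℕ, ENNReal.ofReal (Real.exp (-α)) ^ k *
        (if dist x z < 2 ^ k * s then 1 else 0 : ℝ≥0∞) := by
    intro z
    have hex : ∃ k : ℕ, dist x z < 2 ^ k * s := by
      obtain ⟨k, hk⟩ := pow_unbounded_of_one_lt (dist x z / s) (one_lt_two (α := ℝ))
      exact ⟨k, (div_lt_iff₀ hs).1 hk⟩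
    refine le_trans ?_ (ENNReal.le_tsum (Nat.find hex))
    rw [if_pos (Nat.find_spec hex), mul_one, ← ENNReal.ofReal_pow (Real.exp_pos _).le,
      ← Real.exp_nat_mul]
    refine ENNReal.ofReal_le_ofReal (Real.exp_le_exp.2 ?_)
    -- For the least such index `k + 1`, minimality gives `k + 1 ≤ 2 ^ k ≤ d(x,z) / s`.
    have hk : (Nat.find hex : ℝ) ≤ dist x z / s := by
      rcases hn : Nat.find hex with _ | k
      · simpa using div_nonneg dist_nonneg hs.le
      · have hmin := Nat.find_min hex (m := k) (by omega)
        rw [not_lt, ← le_div_iff₀ hs] at hmin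
        refine le_trans ?_ hmin
        exact_mod_cast Nat.lt_two_pow_self (n := k)
    have := mul_le_mul_of_nonneg_left hk hα0
    rw [mul_div_assoc]
    linarith
  have he : ENNReal.ofReal (Real.exp (-α)) * L ≤ 2⁻¹ := by
    rw [← ENNReal.ofReal_natCast, ← ENNReal.ofReal_mul (Real.exp_pos _).le,
      show (2⁻¹ : ℝ≥0∞) = ENNReal.ofReal 2⁻¹ by
        rw [ENNReal.ofReal_inv_of_pos two_pos, ENNReal.ofReal_ofNat]]
    exact ENNReal.ofReal_le_ofReal (by linarith)
  calc ∑' z : N, ENNReal.ofReal (Real.exp (-(α * dist x z / s)))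
      ≤ ∑' z : N, ∑' k : ℕ, ENNReal.ofReal (Real.exp (-α)) ^ k *
        (if dist x z < 2 ^ k * s then 1 else 0 : ℝ≥0∞) := ENNReal.tsum_le_tsum hpt
    _ = ∑' k : ℕ, ENNReal.ofReal (Real.exp (-α)) ^ k * ∑' z : N,
        (if dist x z < 2 ^ k * s then 1 else 0 : ℝ≥0∞) := by
        rw [ENNReal.tsum_comm]
        simp only [ENNReal.tsum_mul_left]
    _ ≤ ∑' k : ℕ, (L : ℝ≥0∞) * 2⁻¹ ^ k := by
        refine ENNReal.tsum_le_tsum fun k => ?_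
        calc _ ≤ ENNReal.ofReal (Real.exp (-α)) ^ k * (L : ℝ≥0∞) ^ (k + 1) := by
              gcongr
              exact hL.tsum_indicator_le hs hN x k
          _ = L * (ENNReal.ofReal (Real.exp (-α)) * L) ^ k := by ring
          _ ≤ _ := by gcongr
    _ = 2 * L := by
        rw [ENNReal.tsum_mul_left, ENNReal.tsum_geometric, ENNReal.one_sub_inv_two, inv_inv,
          mul_comm]

/-- With `L ≤ 1`, iteration would put two distinct points in one arbitrarily small ball. This keeps
`log L` away from `0`. -/
theorem BallsCoveredBy.two_le {X : Type*} [MetricSpace X] [Nontrivial X] {L : ℕ}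
    (hL : BallsCoveredBy X L) : 2 ≤ L := by
  by_contra! h
  obtain ⟨x, y, hxy⟩ := exists_pair_ne X
  have hd := dist_pos.2 hxy
  obtain ⟨k, hk⟩ := pow_unbounded_of_one_lt (4 : ℝ) (one_lt_two (α := ℝ))
  obtain ⟨t, ht, hcov⟩ := hL.iterate k x (r := 2 * dist x y) (by positivity)
  have ht1 : t.card ≤ 1 := ht.trans (pow_le_one₀ (Nat.zero_le _) (by omega))
  obtain ⟨c, hc, hxc⟩ := Set.mem_iUnion₂.1 (hcov (Metric.mem_ball_self (by positivity)))
  obtain ⟨c', hc', hyc⟩ := Set.mem_iUnion₂.1 (hcov (show y ∈ Metric.ball x (2 * dist x y) by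
    rw [Metric.mem_ball, dist_comm]; linarith))
  rw [Finset.card_le_one.1 ht1 c' hc' c hc] at hyc
  have h1 := dist_triangle_right x y c
  have h2 : 2 * dist x y / 2 ^ k ≤ dist x y / 2 := by
    rw [div_le_div_iff₀ (by positivity) two_pos]
    nlinarith
  rw [Metric.mem_ball] at hxc hyc
  linarith

theorem ballsCoveredBy_toNat_doublingConstant {X : Type*} [MetricSpace X]
    (h : doublingConstant X < ⊤) : BallsCoveredBy X (doublingConstant X).toNat := by
  classical
  have hex : ∃ n, BallsCoveredBy X n := by
    by_contra! hno
    simp [doublingConstant, hno] at h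
  have heq : doublingConstant X = (Nat.find hex : ℕ) := by
    refine le_antisymm (iInf₂_le _ (Nat.find_spec hex)) (le_iInf₂ fun n hn => ?_)
    exact_mod_cast Nat.find_min' hex hn
  rw [heq, ENat.toNat_natCast]
  exact Nat.find_spec hex

/-! ### Softmax weights on a net -/

/-- The softmax weight of `z ∈ N` at `x`, proportional to `exp (-β d(x, z) / s)`. -/
noncomputable def softmaxWeight {X : Type*} [MetricSpace X] (N : Set X) (β s : ℝ) (x : X) (z : N) :
    ℝ :=
  Real.exp (-(β * dist x z / s)) / ∑' z' : N, Real.exp (-(β * dist x z' / s))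

theorem abs_sub_le_mul_add_of_le_exp_mul {u v δ : ℝ} (hu : 0 ≤ u) (hv : 0 ≤ v) (hδ : 0 ≤ δ)
    (huv : u ≤ Real.exp δ * v) (hvu : v ≤ Real.exp δ * u) : |u - v| ≤ δ * (u + v) := by
  have key : ∀ a b : ℝ, 0 ≤ a → 0 ≤ b → a ≤ Real.exp δ * b → a - b ≤ δ * (a + b) := by
    intro a b ha hb hab
    have h1 : Real.exp (-δ) * a ≤ b := by
      calc Real.exp (-δ) * a ≤ Real.exp (-δ) * (Real.exp δ * b) := by gcongr
        _ = b := by rw [← mul_assoc, ← Real.exp_add]; simp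
    have h2 : (1 - δ) * a ≤ Real.exp (-δ) * a := by
      gcongr
      linarith [Real.add_one_le_exp (-δ)]
    nlinarith [mul_nonneg hδ hb]
  exact abs_sub_le_iff.2 ⟨key u v hu hv huv, by linarith [key v u hv hu hvu]⟩

section Softmax

variable {X : Type*} [MetricSpace X] {N : Set X} {β s : ℝ}

theorem softmaxWeight_nonneg (x : X) (z : N) : 0 ≤ softmaxWeight N β s x z :=
  div_nonneg (Real.exp_pos _).le (tsum_nonneg fun _ => (Real.exp_pos _).le)

theorem tsum_ofReal_softmaxWeight [Nonempty N] {x : X}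
    (hsum : Summable fun z : N => Real.exp (-(β * dist x z / s))) :
    ∑' z : N, ENNReal.ofReal (softmaxWeight N β s x z) = 1 := by
  have hS : 0 < ∑' z : N, Real.exp (-(β * dist x z / s)) :=
    hsum.tsum_pos (fun _ => (Real.exp_pos _).le) (Classical.arbitrary N) (Real.exp_pos _)
  rw [← ENNReal.ofReal_tsum_of_nonneg (fun z => softmaxWeight_nonneg x z) (hsum.div_const _)]
  simp only [softmaxWeight]
  rw [tsum_div_const, div_self hS.ne', ENNReal.ofReal_one]

theorem exp_neg_dist_le (hβ : 0 ≤ β) (hs : 0 < s) (x y : X) (z : N) :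
    Real.exp (-(β * dist x z / s)) ≤
      Real.exp (β * dist x y / s) * Real.exp (-(β * dist y z / s)) := by
  rw [← Real.exp_add, Real.exp_le_exp]
  have h : β * dist y z / s ≤ β * dist x y / s + β * dist x z / s := by
    rw [← add_div, ← mul_add]
    gcongr
    exact dist_triangle_left _ _ _
  linarith

/-- The numerator and the normalising sum each change by a factor at most `exp (β d(x,y) / s)`,
hence the `2`. -/
theorem softmaxWeight_le_exp_mul [Nonempty N] (hβ : 0 ≤ β) (hs : 0 < s)
    (hsum : ∀ x : X, Summable fun z : N => Real.exp (-(β * dist x z / s))) (x y : X) (z : N) :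
    softmaxWeight N β s x z ≤ Real.exp (2 * (β * dist x y / s)) * softmaxWeight N β s y z := by
  have hpos : ∀ x : X, 0 < ∑' z : N, Real.exp (-(β * dist x z / s)) := fun x =>
    (hsum x).tsum_pos (fun _ => (Real.exp_pos _).le) (Classical.arbitrary N) (Real.exp_pos _)
  have hS : ∑' z : N, Real.exp (-(β * dist y z / s)) ≤
      Real.exp (β * dist x y / s) * ∑' z : N, Real.exp (-(β * dist x z / s)) := by
    rw [← tsum_mul_left]
    refine (hsum y).tsum_le_tsum (fun z => ?_) ((hsum x).mul_left _)
    rw [dist_comm x y]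
    exact exp_neg_dist_le hβ hs y x z
  have hw := exp_neg_dist_le hβ hs x y z
  unfold softmaxWeight
  rw [← mul_div_assoc, div_le_div_iff₀ (hpos x) (hpos y), two_mul, Real.exp_add]
  calc _ ≤ (Real.exp (β * dist x y / s) * Real.exp (-(β * dist y z / s))) *
        (Real.exp (β * dist x y / s) * ∑' z : N, Real.exp (-(β * dist x z / s))) :=
        mul_le_mul hw hS (hpos y).le (by positivity)
    _ = _ := by ring

theorem abs_softmaxWeight_sub_le [Nonempty N] (hβ : 0 ≤ β) (hs : 0 < s)
    (hsum : ∀ x : X, Summable fun z : N => Real.exp (-(β * dist x z / s))) (x y : X) (z : N) :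
    |softmaxWeight N β s x z - softmaxWeight N β s y z| ≤
      2 * (β * dist x y / s) * (softmaxWeight N β s x z + softmaxWeight N β s y z) := by
  refine abs_sub_le_mul_add_of_le_exp_mul (softmaxWeight_nonneg _ _) (softmaxWeight_nonneg _ _)
    (by positivity) (softmaxWeight_le_exp_mul hβ hs hsum x y z) ?_
  rw [dist_comm]
  exact softmaxWeight_le_exp_mul hβ hs hsum y x z

/-- Under the softmax law, the expected distance to `x` is at most `17 s`, provided that some
point of `N` lies within `8 s` of `x`. -/
theorem BallsCoveredBy.tsum_dist_mul_softmaxWeight_le {L : ℕ} (hL : BallsCoveredBy X L)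
    (hs : 0 < s) (hN : N.Pairwise fun a b => s ≤ dist a b) (hβ4 : 4 ≤ β)
    (hβ : Real.exp (-(β / 8)) * (2 * L) ≤ 1)
    (hsum : ∀ x : X, Summable fun z : N => Real.exp (-(β * dist x z / s))) {x : X} {z₀ : X}
    (hz₀ : z₀ ∈ N) (hxz₀ : dist x z₀ ≤ 8 * s) :
    ∑' z : N, ENNReal.ofReal (dist x z * softmaxWeight N β s x z) ≤ ENNReal.ofReal (17 * s) := by
  have : Nonempty N := ⟨⟨z₀, hz₀⟩⟩
  have hS : Real.exp (-(8 * β)) ≤ ∑' z : N, Real.exp (-(β * dist x z / s)) := by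
    refine le_trans (Real.exp_le_exp.2 ?_)
      ((hsum x).le_tsum ⟨z₀, hz₀⟩ fun _ _ => (Real.exp_pos _).le)
    have : β * dist x z₀ / s ≤ β * (8 * s) / s := by gcongr
    rw [show β * (8 * s) / s = 8 * β by field_simp] at this
    simpa using this
  -- Points within `16 s` contribute at most `16 s` in total. Farther out, `exp (-β ρ)` beats both
  -- the normaliser `exp (-8β)` and the factor `ρ`.
  have hpt : ∀ z : N, dist x z * softmaxWeight N β s x z ≤ 16 * s * softmaxWeight N β s x z +
      s * Real.exp (-(2 * β)) * Real.exp (-(β / 8 * dist x z / s)) := by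
    intro z
    rcases le_or_gt (dist x z) (16 * s) with hd | hd
    · have := mul_le_mul_of_nonneg_right hd (softmaxWeight_nonneg (β := β) (s := s) x z)
      have : 0 ≤ s * Real.exp (-(2 * β)) * Real.exp (-(β / 8 * dist x z / s)) := by positivity
      linarith
    · set ρ := dist x z / s with hρ
      have hρ16 : 16 ≤ ρ := by rw [hρ, le_div_iff₀ hs]; exact hd.le
      have h1 : dist x z = s * ρ := by rw [hρ]; field_simp
      have h2 : softmaxWeight N β s x z ≤ Real.exp (8 * β - β * ρ) := by
        have : Real.exp (8 * β - β * ρ) = Real.exp (-(β * dist x z / s)) / Real.exp (-(8 * β)) := by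
          rw [← Real.exp_sub, mul_div_assoc]
          congr 1
          ring
        rw [this, softmaxWeight]
        gcongr
      have h3 : ρ ≤ Real.exp (β * ρ / 4) := by
        have : ρ ≤ β * ρ / 4 := by nlinarith
        linarith [Real.add_one_le_exp (β * ρ / 4)]
      have h4 : dist x z * softmaxWeight N β s x z ≤
          s * Real.exp (-(2 * β)) * Real.exp (-(β / 8 * dist x z / s)) := by
        calc dist x z * softmaxWeight N β s x z
            ≤ s * Real.exp (β * ρ / 4) * Real.exp (8 * β - β * ρ) := by
              rw [h1]
              exact mul_le_mul (by gcongr) h2 (softmaxWeight_nonneg _ _) (by positivity)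
          _ ≤ _ := by
              rw [mul_assoc, mul_assoc, ← Real.exp_add, ← Real.exp_add, mul_div_assoc (β / 8), ← hρ]
              refine mul_le_mul_of_nonneg_left (Real.exp_le_exp.2 ?_) hs.le
              -- The exponents compare when `10 β ≤ (5/8) β ρ`, that is, when `ρ ≥ 16`.
              have := mul_le_mul_of_nonneg_left hρ16 (by linarith : 0 ≤ β)
              linarith
      have := mul_nonneg (mul_nonneg (by norm_num : (0 : ℝ) ≤ 16) hs.le)
        (softmaxWeight_nonneg (β := β) (s := s) x z)
      linarith
  have htail : ENNReal.ofReal (s * Real.exp (-(2 * β))) *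
      ∑' z : N, ENNReal.ofReal (Real.exp (-(β / 8 * dist x z / s))) ≤ ENNReal.ofReal s := by
    refine (mul_le_mul_right (hL.tsum_exp_le hs hN (by linarith) hβ x) _).trans ?_
    rw [show (2 * L : ℝ≥0∞) = ENNReal.ofReal (2 * L) by
      rw [ENNReal.ofReal_mul two_pos.le]; simp, ← ENNReal.ofReal_mul (by positivity)]
    refine ENNReal.ofReal_le_ofReal ?_
    have h5 : Real.exp (-(2 * β)) ≤ Real.exp (-(β / 8)) := Real.exp_le_exp.2 (by linarith)
    have h6 : Real.exp (-(2 * β)) * (2 * L) ≤ 1 := le_trans (by gcongr) hβ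
    nlinarith
  calc ∑' z : N, ENNReal.ofReal (dist x z * softmaxWeight N β s x z)
      ≤ ∑' z : N, (ENNReal.ofReal (16 * s) * ENNReal.ofReal (softmaxWeight N β s x z) +
        ENNReal.ofReal (s * Real.exp (-(2 * β))) *
          ENNReal.ofReal (Real.exp (-(β / 8 * dist x z / s)))) := by
        refine ENNReal.tsum_le_tsum fun z => ?_
        rw [← ENNReal.ofReal_mul (by positivity), ← ENNReal.ofReal_mul (by positivity)]
        exact (ENNReal.ofReal_le_ofReal (hpt z)).trans ENNReal.ofReal_add_le
    _ ≤ ENNReal.ofReal (16 * s) * 1 + ENNReal.ofReal s := by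
        rw [ENNReal.tsum_add, ENNReal.tsum_mul_left, ENNReal.tsum_mul_left,
          tsum_ofReal_softmaxWeight (hsum x)]
        gcongr
    _ = ENNReal.ofReal (17 * s) := by
        rw [mul_one, ← ENNReal.ofReal_add (by positivity) hs.le]
        congr 1
        ring

end Softmax

/-! ### A partition of unity over logarithmic scales -/

/-- The piecewise linear partition of unity of `ℝ` subordinate to the integers. -/
noncomputable def tent (u : ℝ) (n : ℤ) : ℝ := max 0 (1 - |u - n|)

theorem tent_nonneg (u : ℝ) (n : ℤ) : 0 ≤ tent u n := le_max_left _ _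

theorem abs_sub_lt_one_of_tent_ne_zero {u : ℝ} {n : ℤ} (h : tent u n ≠ 0) : |u - n| < 1 := by
  by_contra! h1
  exact h (max_eq_left (by linarith))

theorem eq_floor_or_of_tent_ne_zero {u : ℝ} {n : ℤ} (h : tent u n ≠ 0) :
    n = ⌊u⌋ ∨ n = ⌊u⌋ + 1 := by
  have h1 := abs_lt.1 (abs_sub_lt_one_of_tent_ne_zero h)
  have h2 := Int.floor_le u
  have h3 := Int.lt_floor_add_one u
  have h4 : (n : ℝ) < ((⌊u⌋ + 2 : ℤ) : ℝ) := by push_cast; linarith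
  have h5 : ((⌊u⌋ - 1 : ℤ) : ℝ) < n := by push_cast; linarith
  have h6 : n < ⌊u⌋ + 2 := by exact_mod_cast h4
  have h7 : ⌊u⌋ - 1 < n := by exact_mod_cast h5
  omega

theorem tsum_ofReal_tent (u : ℝ) : ∑' n : ℤ, ENNReal.ofReal (tent u n) = 1 := by
  have h2 := Int.floor_le u
  have h3 := Int.lt_floor_add_one u
  rw [tsum_eq_sum (s := {⌊u⌋, ⌊u⌋ + 1}) fun n hn => ?_]
  · rw [Finset.sum_pair (by omega), ← ENNReal.ofReal_add (tent_nonneg _ _) (tent_nonneg _ _)]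
    have h4 : tent u ⌊u⌋ = 1 - (u - ⌊u⌋) := by
      rw [tent, abs_of_nonneg (by linarith), max_eq_right (by linarith)]
    have h5 : tent u (⌊u⌋ + 1) = u - ⌊u⌋ := by
      rw [tent]
      push_cast
      rw [abs_of_nonpos (by linarith), max_eq_right (by linarith)]
      ring
    rw [h4, h5]
    simp
  · by_contra hne
    have h6 : tent u n ≠ 0 := fun h0 => hne (by rw [h0, ENNReal.ofReal_zero])
    exact hn (by simpa using eq_floor_or_of_tent_ne_zero h6)

theorem abs_tent_sub_le (u v : ℝ) (n : ℤ) : |tent u n - tent v n| ≤ |u - v| := by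
  refine (abs_max_sub_max_le_max _ _ _ _).trans ?_
  rw [sub_self, abs_zero, max_eq_right (abs_nonneg _)]
  have := abs_abs_sub_abs_le_abs_sub (v - n) (u - n)
  rw [show (1 - |u - n| - (1 - |v - n|) : ℝ) = |v - n| - |u - n| by ring, abs_sub_comm u v]
  simpa using this

/-! ### Nets at all scales and the gentle weights -/

/-- `N n` is a maximal `exp n`-separated subset of `M`, for every integer `n`. -/
structure IsNetFamily {X : Type*} [MetricSpace X] (M : Set X) (N : ℤ → Set X) : Prop where
  subset : ∀ n, N n ⊆ M
  separated : ∀ n, (N n).Pairwise fun a b => Real.exp n ≤ dist a b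
  exists_dist_lt : ∀ n, ∀ m ∈ M, ∃ z ∈ N n, dist m z < Real.exp n

theorem exists_isNetFamily {X : Type*} [MetricSpace X] (M : Set X) :
    ∃ N : ℤ → Set X, IsNetFamily M N := by
  choose N hN1 hN2 hN3 using fun n : ℤ => exists_separated_net M (Real.exp_pos n)
  exact ⟨N, hN1, hN2, hN3⟩

open Classical in
/-- Softmax weights over the nets `N n`, combined over the scales `exp n` comparable to the
distance from `x` to `M`. -/
noncomputable def gentleWeight {X : Type*} [MetricSpace X] (M : Set X) (N : ℤ → Set X) (β : ℝ)
    (ω : Σ n, N n) (x : X) : ℝ :=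
  if x ∈ M then 0
  else tent (Real.log (Metric.infDist x M)) ω.1 * softmaxWeight (N ω.1) β (Real.exp ω.1) x ω.2

theorem scale_bounds_of_tent_log_ne_zero {t : ℝ} (ht : 0 < t) {n : ℤ}
    (h : tent (Real.log t) n ≠ 0) : t ≤ 3 * Real.exp n ∧ Real.exp n ≤ 3 * t := by
  have h1 := abs_lt.1 (abs_sub_lt_one_of_tent_ne_zero h)
  have he : Real.exp 1 ≤ 3 := by linarith [Real.exp_one_lt_d9]
  constructor
  · calc t = Real.exp (Real.log t) := (Real.exp_log ht).symm
      _ ≤ Real.exp (1 + n) := Real.exp_le_exp.2 (by linarith)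
      _ = Real.exp 1 * Real.exp n := Real.exp_add _ _
      _ ≤ _ := by gcongr
  · calc Real.exp n ≤ Real.exp (1 + Real.log t) := Real.exp_le_exp.2 (by linarith)
      _ = Real.exp 1 * t := by rw [Real.exp_add, Real.exp_log ht]
      _ ≤ _ := by gcongr

/-- Both signs follow from `log r ≤ r - 1`, with `r = u / t` and `r = t / u`; the second costs the
factor `2` through `u ≥ t / 2`. -/
theorem abs_log_sub_log_le {t u : ℝ} (ht : 0 < t) (hu : t / 2 ≤ u) :
    |Real.log t - Real.log u| ≤ 2 * |t - u| / t := by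
  have hu0 : 0 < u := by linarith
  rw [← Real.log_div ht.ne' hu0.ne']
  refine abs_le.2 ⟨?_, ?_⟩
  · have h1 := Real.log_le_sub_one_of_pos (div_pos hu0 ht)
    rw [← inv_div u t, Real.log_inv]
    have h2 : u / t - 1 ≤ 2 * |t - u| / t := by
      rw [div_sub_one ht.ne']
      gcongr
      have := neg_abs_le (t - u)
      linarith [abs_nonneg (t - u)]
    linarith
  · have h1 := Real.log_le_sub_one_of_pos (div_pos ht hu0)
    refine h1.trans ?_
    rw [div_sub_one hu0.ne', div_le_div_iff₀ hu0 ht]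
    have := le_abs_self (t - u)
    nlinarith [abs_nonneg (t - u)]

/-! ### Gentleness estimates -/

section GentleWeight

variable {X : Type*} [MetricSpace X] {M : Set X} {N : ℤ → Set X} {β : ℝ} {L : ℕ}

theorem gentleWeight_nonneg (ω : Σ n, N n) (x : X) : 0 ≤ gentleWeight M N β ω x := by
  unfold gentleWeight
  split_ifs
  · exact le_rfl
  · exact mul_nonneg (tent_nonneg _ _) (softmaxWeight_nonneg _ _)

theorem gentleWeight_of_mem {x : X} (hx : x ∈ M) (ω : Σ n, N n) : gentleWeight M N β ω x = 0 :=
  if_pos hx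

theorem gentleWeight_of_notMem {x : X} (hx : x ∉ M) (ω : Σ n, N n) :
    gentleWeight M N β ω x =
      tent (Real.log (Metric.infDist x M)) ω.1 * softmaxWeight (N ω.1) β (Real.exp ω.1) x ω.2 :=
  if_neg hx

theorem IsNetFamily.nonempty (hN : IsNetFamily M N) (hM : M.Nonempty) (n : ℤ) :
    Nonempty (N n) := by
  obtain ⟨m, hm⟩ := hM
  obtain ⟨z, hz, -⟩ := hN.exists_dist_lt n m hm
  exact ⟨⟨z, hz⟩⟩

theorem IsNetFamily.summable (hN : IsNetFamily M N) (hL : BallsCoveredBy X L) (hβ0 : 0 ≤ β)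
    (hβ : Real.exp (-(β / 8)) * (2 * L) ≤ 1) (n : ℤ) (x : X) :
    Summable fun z : N n => Real.exp (-(β * dist x z / Real.exp n)) := by
  have hβ' : Real.exp (-β) * (2 * L) ≤ 1 := by
    refine le_trans ?_ hβ
    gcongr
    linarith
  have h := hL.tsum_exp_le (Real.exp_pos n) (hN.separated n) hβ0 hβ' x
  have hne : (2 * L : ℝ≥0∞) ≠ ∞ := ENNReal.mul_ne_top (by simp) (by simp)
  refine (ENNReal.summable_toReal (ne_top_of_le_ne_top hne h)).congr fun z => ?_
  rw [ENNReal.toReal_ofReal (Real.exp_pos _).le]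

theorem IsNetFamily.tsum_dist_mul_softmaxWeight_le (hN : IsNetFamily M N) (hM : M.Nonempty)
    (hL : BallsCoveredBy X L) (hβ4 : 4 ≤ β) (hβ : Real.exp (-(β / 8)) * (2 * L) ≤ 1) {n : ℤ}
    {x : X} (hx : Metric.infDist x M ≤ 6 * Real.exp n) :
    ∑' z : N n, ENNReal.ofReal (dist x z * softmaxWeight (N n) β (Real.exp n) x z) ≤
      ENNReal.ofReal (17 * Real.exp n) := by
  have hs := Real.exp_pos n
  obtain ⟨m, hm, hxm⟩ := (Metric.infDist_lt_iff hM).1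
    (show Metric.infDist x M < 7 * Real.exp n by linarith)
  obtain ⟨z, hz, hmz⟩ := hN.exists_dist_lt n m hm
  refine hL.tsum_dist_mul_softmaxWeight_le hs (hN.separated n) hβ4 hβ
    (hN.summable hL (by linarith) hβ n) hz ?_
  linarith [dist_triangle x m z]

theorem IsNetFamily.tsum_ofReal_gentleWeight (hN : IsNetFamily M N) (hM : M.Nonempty)
    (hL : BallsCoveredBy X L) (hβ0 : 0 ≤ β) (hβ : Real.exp (-(β / 8)) * (2 * L) ≤ 1) {x : X}
    (hx : x ∉ M) : ∑' ω, ENNReal.ofReal (gentleWeight M N β ω x) = 1 := by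
  have := hN.nonempty hM
  rw [ENNReal.tsum_sigma']
  simp only [gentleWeight_of_notMem hx, ENNReal.ofReal_mul (tent_nonneg _ _),
    ENNReal.tsum_mul_left, tsum_ofReal_softmaxWeight (hN.summable hL hβ0 hβ _ x), mul_one,
    tsum_ofReal_tent]

theorem IsNetFamily.tsum_ofReal_gentleWeight_le_one (hN : IsNetFamily M N) (hM : M.Nonempty)
    (hL : BallsCoveredBy X L) (hβ0 : 0 ≤ β) (hβ : Real.exp (-(β / 8)) * (2 * L) ≤ 1) (x : X) :
    ∑' ω, ENNReal.ofReal (gentleWeight M N β ω x) ≤ 1 := by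
  by_cases hx : x ∈ M
  · simp [gentleWeight_of_mem hx]
  · exact (hN.tsum_ofReal_gentleWeight hM hL hβ0 hβ hx).le

theorem IsNetFamily.tsum_dist_mul_gentleWeight_le (hN : IsNetFamily M N) (hMc : IsClosed M)
    (hM : M.Nonempty) (hL : BallsCoveredBy X L) (hβ4 : 4 ≤ β)
    (hβ : Real.exp (-(β / 8)) * (2 * L) ≤ 1) (x : X) :
    ∑' ω : Σ n, N n, ENNReal.ofReal (dist x ω.2 * gentleWeight M N β ω x) ≤
      ENNReal.ofReal (51 * Metric.infDist x M) := by
  by_cases hx : x ∈ M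
  · simp [gentleWeight_of_mem hx]
  have ht := (hMc.notMem_iff_infDist_pos hM).1 hx
  rw [ENNReal.tsum_sigma']
  calc _ ≤ ∑' n : ℤ, ENNReal.ofReal (tent (Real.log (Metric.infDist x M)) n) *
        ENNReal.ofReal (51 * Metric.infDist x M) := by
        refine ENNReal.tsum_le_tsum fun n => ?_
        simp only [gentleWeight_of_notMem hx, mul_left_comm (dist x _),
          ENNReal.ofReal_mul (tent_nonneg _ _), ENNReal.tsum_mul_left]
        by_cases h0 : tent (Real.log (Metric.infDist x M)) n = 0
        · simp [h0]
        have hsc := scale_bounds_of_tent_log_ne_zero ht h0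
        gcongr
        refine (hN.tsum_dist_mul_softmaxWeight_le hM hL hβ4 hβ ?_).trans
          (ENNReal.ofReal_le_ofReal ?_)
        · linarith [Real.exp_pos n]
        · linarith
    _ = _ := by rw [ENNReal.tsum_mul_right, tsum_ofReal_tent, one_mul]

/-- The bound when `x` is no farther from `M` than about `d(x, y)`. -/
theorem IsNetFamily.tsum_gentle_le_of_infDist_le (hN : IsNetFamily M N) (hMc : IsClosed M)
    (hM : M.Nonempty) (hL : BallsCoveredBy X L) (hβ4 : 4 ≤ β)
    (hβ : Real.exp (-(β / 8)) * (2 * L) ≤ 1) {x y : X} (hxy : Metric.infDist x M ≤ 2 * dist x y) :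
    ∑' ω : Σ n, N n, ENNReal.ofReal
      (dist x ω.2 * |gentleWeight M N β ω x - gentleWeight M N β ω y|) ≤
      ENNReal.ofReal (256 * dist x y) := by
  have hy : Metric.infDist y M ≤ 3 * dist x y := by
    have := Metric.infDist_le_infDist_add_dist (s := M) (x := y) (y := x)
    rw [dist_comm y x] at this
    linarith
  calc _ ≤ ∑' ω : Σ n, N n, (ENNReal.ofReal (dist x ω.2 * gentleWeight M N β ω x) +
        (ENNReal.ofReal (dist y ω.2 * gentleWeight M N β ω y) +
          ENNReal.ofReal (dist x y) * ENNReal.ofReal (gentleWeight M N β ω y))) := by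
        refine ENNReal.tsum_le_tsum fun ω => ?_
        have h1 := gentleWeight_nonneg (M := M) (β := β) ω x
        have h2 := gentleWeight_nonneg (M := M) (β := β) ω y
        have h3 : 0 ≤ dist x (ω.2 : X) := dist_nonneg
        have h4 : 0 ≤ dist y (ω.2 : X) := dist_nonneg
        have h5 : 0 ≤ dist x y := dist_nonneg
        rw [← ENNReal.ofReal_mul h5, ← ENNReal.ofReal_add (by positivity) (by positivity),
          ← ENNReal.ofReal_add (by positivity) (by positivity)]
        refine ENNReal.ofReal_le_ofReal ?_
        have h6 : |gentleWeight M N β ω x - gentleWeight M N β ω y| ≤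
            gentleWeight M N β ω x + gentleWeight M N β ω y :=
          abs_sub_le_iff.2 ⟨by linarith, by linarith⟩
        have h7 := mul_le_mul_of_nonneg_left h6 h3
        have h8 := mul_le_mul_of_nonneg_right (dist_triangle x y (ω.2 : X)) h2
        linarith
    _ ≤ ENNReal.ofReal (51 * Metric.infDist x M) + (ENNReal.ofReal (51 * Metric.infDist y M) +
          ENNReal.ofReal (dist x y) * 1) := by
        rw [ENNReal.tsum_add, ENNReal.tsum_add, ENNReal.tsum_mul_left]
        gcongr
        · exact hN.tsum_dist_mul_gentleWeight_le hMc hM hL hβ4 hβ x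
        · exact hN.tsum_dist_mul_gentleWeight_le hMc hM hL hβ4 hβ y
        · exact hN.tsum_ofReal_gentleWeight_le_one hM hL (by linarith) hβ y
    _ ≤ _ := by
        -- The constant is `256 = 51 * 2 + 51 * 3 + 1`.
        have h1 : 0 ≤ Metric.infDist x M := Metric.infDist_nonneg
        have h2 : 0 ≤ Metric.infDist y M := Metric.infDist_nonneg
        rw [mul_one, ← ENNReal.ofReal_add (by positivity) dist_nonneg,
          ← ENNReal.ofReal_add (by positivity) (by positivity)]
        exact ENNReal.ofReal_le_ofReal (by linarith)

/-- The contribution of a single scale, comparable to the distances of `x` and `y` to `M`. -/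
theorem IsNetFamily.tsum_scale_le (hN : IsNetFamily M N) (hM : M.Nonempty)
    (hL : BallsCoveredBy X L) (hβ4 : 4 ≤ β) (hβ : Real.exp (-(β / 8)) * (2 * L) ≤ 1) {x y : X}
    {n : ℤ} (hx : Metric.infDist x M ≤ 6 * Real.exp n) (hy : Metric.infDist y M ≤ 6 * Real.exp n)
    (hd : dist x y ≤ 3 * Real.exp n) (a : ℝ) {b : ℝ} (hb : 0 ≤ b) :
    ∑' z : N n, ENNReal.ofReal (dist x z * |a * softmaxWeight (N n) β (Real.exp n) x z -
        b * softmaxWeight (N n) β (Real.exp n) y z|) ≤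
      ENNReal.ofReal (17 * Real.exp n * |a - b|) + ENNReal.ofReal (74 * β * dist x y * b) := by
  have := hN.nonempty hM n
  have hs := Real.exp_pos n
  have hβ0 : 0 ≤ β := by linarith
  have hsum := hN.summable hL hβ0 hβ n
  set s := Real.exp n
  set p := softmaxWeight (N n) β s with hp
  set ε := 2 * (β * dist x y / s) with hε
  have hε0 : 0 ≤ ε := by positivity
  calc ∑' z : N n, ENNReal.ofReal (dist x z * |a * p x z - b * p y z|)
      ≤ ∑' z : N n, (ENNReal.ofReal |a - b| * ENNReal.ofReal (dist x z * p x z) +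
        ENNReal.ofReal (b * ε) * (ENNReal.ofReal (dist x z * p x z) +
          (ENNReal.ofReal (dist y z * p y z) +
            ENNReal.ofReal (dist x y) * ENNReal.ofReal (p y z)))) := by
        refine ENNReal.tsum_le_tsum fun z => ?_
        have h1 : 0 ≤ p x z := softmaxWeight_nonneg _ _
        have h2 : 0 ≤ p y z := softmaxWeight_nonneg _ _
        have h3 : 0 ≤ dist x (z : X) := dist_nonneg
        have h4 : 0 ≤ dist y (z : X) := dist_nonneg
        have h5 : 0 ≤ dist x y := dist_nonneg
        rw [← ENNReal.ofReal_mul h5, ← ENNReal.ofReal_add (by positivity) (by positivity),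
          ← ENNReal.ofReal_add (by positivity) (by positivity),
          ← ENNReal.ofReal_mul (by positivity), ← ENNReal.ofReal_mul (by positivity),
          ← ENNReal.ofReal_add (by positivity) (by positivity)]
        refine ENNReal.ofReal_le_ofReal ?_
        have h6 : |p x z - p y z| ≤ ε * (p x z + p y z) :=
          abs_softmaxWeight_sub_le hβ0 hs hsum x y z
        have h7 : |a * p x z - b * p y z| ≤ |a - b| * p x z + b * |p x z - p y z| := by
          rw [show a * p x z - b * p y z = (a - b) * p x z + b * (p x z - p y z) by ring]
          refine (abs_add_le _ _).trans_eq ?_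
          rw [abs_mul, abs_mul, abs_of_nonneg h1, abs_of_nonneg hb]
        have h8 : dist x z * p y z ≤ dist y z * p y z + dist x y * p y z := by
          have := mul_le_mul_of_nonneg_right (dist_triangle x y (z : X)) h2
          linarith
        calc dist x z * |a * p x z - b * p y z|
            ≤ dist x z * (|a - b| * p x z + b * (ε * (p x z + p y z))) := by
              gcongr
              exact h7.trans (by gcongr)
          _ = |a - b| * (dist x z * p x z) + b * ε * (dist x z * p x z + dist x z * p y z) := by
              ring
          _ ≤ _ := by gcongr
    _ ≤ ENNReal.ofReal |a - b| * ENNReal.ofReal (17 * s) + ENNReal.ofReal (b * ε) *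
        (ENNReal.ofReal (17 * s) + (ENNReal.ofReal (17 * s) + ENNReal.ofReal (dist x y) * 1)) := by
        simp only [ENNReal.tsum_add, ENNReal.tsum_mul_left]
        rw [hp, tsum_ofReal_softmaxWeight (hsum y)]
        gcongr
        · exact hN.tsum_dist_mul_softmaxWeight_le hM hL hβ4 hβ hx
        · exact hN.tsum_dist_mul_softmaxWeight_le hM hL hβ4 hβ hx
        · exact hN.tsum_dist_mul_softmaxWeight_le hM hL hβ4 hβ hy
    _ ≤ _ := by
        rw [mul_one, ← ENNReal.ofReal_add (by positivity) dist_nonneg,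
          ← ENNReal.ofReal_add (by positivity) (by positivity),
          ← ENNReal.ofReal_mul (abs_nonneg _), ← ENNReal.ofReal_mul (by positivity)]
        gcongr ENNReal.ofReal ?_ + ENNReal.ofReal ?_
        · rw [mul_comm]
        -- Here `37 = 17 + 17 + 3`, and `ε s = 2 β d(x,y)` cancels the scale.
        · calc b * ε * (17 * s + (17 * s + dist x y)) ≤ b * ε * (37 * s) := by
                gcongr
                linarith
            _ = 74 * β * dist x y * b := by
                rw [hε]
                field_simp
                ring

/-- The bound when `d(x, y)` is small compared with the distance from `x` to `M`. -/
theorem IsNetFamily.tsum_gentle_le_of_lt_infDist (hN : IsNetFamily M N) (hMc : IsClosed M)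
    (hM : M.Nonempty) (hL : BallsCoveredBy X L) (hβ4 : 4 ≤ β)
    (hβ : Real.exp (-(β / 8)) * (2 * L) ≤ 1) {x y : X} (hxy : 2 * dist x y < Metric.infDist x M) :
    ∑' ω : Σ n, N n, ENNReal.ofReal
      (dist x ω.2 * |gentleWeight M N β ω x - gentleWeight M N β ω y|) ≤
      ENNReal.ofReal ((612 + 74 * β) * dist x y) := by
  have hd0 : 0 ≤ dist x y := dist_nonneg
  have h1 := Metric.infDist_le_infDist_add_dist (s := M) (x := y) (y := x)
  have h2 := Metric.infDist_le_infDist_add_dist (s := M) (x := x) (y := y)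
  rw [dist_comm y x] at h1
  have htx : 0 < Metric.infDist x M := by linarith
  have hty : 0 < Metric.infDist y M := by linarith
  have hx := (hMc.notMem_iff_infDist_pos hM).2 htx
  have hy := (hMc.notMem_iff_infDist_pos hM).2 hty
  set t := Metric.infDist x M
  set u := Metric.infDist y M
  -- Only these scales, at most four, are active at `x` or at `y`.
  set F : Finset ℤ :=
    {⌊Real.log t⌋, ⌊Real.log t⌋ + 1, ⌊Real.log u⌋, ⌊Real.log u⌋ + 1} with hF
  have hFcard : F.card ≤ 4 := Finset.card_le_four
  have hlog : ∀ n : ℤ, t * |tent (Real.log t) n - tent (Real.log u) n| ≤ 2 * dist x y := by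
    intro n
    have h3 : |t - u| ≤ dist x y := abs_sub_le_iff.2 ⟨by linarith, by linarith⟩
    have h4 := (abs_tent_sub_le (Real.log t) (Real.log u) n).trans
      (abs_log_sub_log_le htx (by linarith))
    rw [le_div_iff₀ htx] at h4
    linarith
  rw [ENNReal.tsum_sigma']
  simp only [gentleWeight_of_notMem hx, gentleWeight_of_notMem hy]
  calc _ ≤ ∑' n : ℤ, ((if n ∈ F then ENNReal.ofReal (153 * dist x y) else 0) +
        ENNReal.ofReal (74 * β * dist x y) * ENNReal.ofReal (tent (Real.log u) n)) := by
        refine ENNReal.tsum_le_tsum fun n => ?_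
        by_cases h0 : tent (Real.log t) n = 0 ∧ tent (Real.log u) n = 0
        · change ∑' z : N n, ENNReal.ofReal (dist x z * |tent (Real.log t) n * _ -
            tent (Real.log u) n * _|) ≤ _
          simp [h0.1, h0.2]
        have hnF : n ∈ F := by
          by_cases h0t : tent (Real.log t) n = 0
          · have := eq_floor_or_of_tent_ne_zero fun h => h0 ⟨h0t, h⟩
            simp only [hF, Finset.mem_insert, Finset.mem_singleton]
            tauto
          · have := eq_floor_or_of_tent_ne_zero h0t
            simp only [hF, Finset.mem_insert, Finset.mem_singleton]
            tauto
        -- Either `t` or `u` is within a factor `3` of `exp n`, and `t / 2 < u < 3 t / 2`.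
        have hscale : t ≤ 6 * Real.exp n ∧ u ≤ 6 * Real.exp n ∧ Real.exp n ≤ 4.5 * t := by
          by_cases h0t : tent (Real.log t) n = 0
          · have := scale_bounds_of_tent_log_ne_zero hty fun h => h0 ⟨h0t, h⟩
            refine ⟨?_, ?_, ?_⟩ <;> linarith
          · have := scale_bounds_of_tent_log_ne_zero htx h0t
            refine ⟨?_, ?_, ?_⟩ <;> linarith
        obtain ⟨hs1, hs2, hs3⟩ := hscale
        rw [if_pos hnF, ← ENNReal.ofReal_mul (by positivity)]
        refine (hN.tsum_scale_le hM hL hβ4 hβ hs1 hs2 (by linarith) _ (tent_nonneg _ _)).trans ?_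
        gcongr ENNReal.ofReal ?_ + _
        -- `17 * 4.5 * 2 = 153`, by `hlog`; four scales then give `612`.
        have h5 := mul_le_mul_of_nonneg_right hs3
          (abs_nonneg (tent (Real.log t) n - tent (Real.log u) n))
        linarith [hlog n]
    _ = F.card * ENNReal.ofReal (153 * dist x y) + ENNReal.ofReal (74 * β * dist x y) := by
        rw [ENNReal.tsum_add, ENNReal.tsum_mul_left, tsum_ofReal_tent, mul_one,
          tsum_eq_sum (s := F) fun n hn => if_neg hn, Finset.sum_congr rfl fun n hn => if_pos hn,
          Finset.sum_const, nsmul_eq_mul]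
    _ ≤ ENNReal.ofReal 4 * ENNReal.ofReal (153 * dist x y) +
        ENNReal.ofReal (74 * β * dist x y) := by
        gcongr
        rw [ENNReal.ofReal_ofNat]
        exact_mod_cast hFcard
    _ = _ := by
        rw [← ENNReal.ofReal_mul (by norm_num), ← ENNReal.ofReal_add (by positivity) (by positivity)]
        congr 1
        ring

/-- Counting measure on the discrete index set turns integrals into sums and makes measurability
automatic. For `β ≥ 8`, `200 β` dominates both `256` and `612 + 74 β`. -/
theorem IsNetFamily.isGentlePartitionOfUnity [MeasurableSpace X] (hN : IsNetFamily M N)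
    (hMc : IsClosed M) (hM : M.Nonempty) (hL : BallsCoveredBy X L) (hβ8 : 8 ≤ β)
    (hβ : Real.exp (-(β / 8)) * (2 * L) ≤ 1) :
    @IsGentlePartitionOfUnity X (Σ n, N n) _ _ ⊤ (@Measure.count _ ⊤) (200 * β) M
      (gentleWeight M N β) (fun ω => ⟨ω.2, hN.subset _ ω.2.2⟩) := by
  let : MeasurableSpace (Σ n, N n) := ⊤
  have hβ4 : 4 ≤ β := by linarith
  refine ⟨by linarith, gentleWeight_nonneg, fun x hx ω => gentleWeight_of_mem hx ω,
    fun _ _ => measurable_from_top, fun x hx => ?_, measurable_from_top, fun x y => ?_⟩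
  · rw [lintegral_count' measurable_from_top]
    exact hN.tsum_ofReal_gentleWeight hM hL (by linarith) hβ hx
  · rw [lintegral_count' measurable_from_top]
    simp only [dist_comm _ x]
    have hd : 0 ≤ dist x y := dist_nonneg
    rcases le_or_gt (Metric.infDist x M) (2 * dist x y) with h | h
    · exact (hN.tsum_gentle_le_of_infDist_le hMc hM hL hβ4 hβ h).trans
        (ENNReal.ofReal_le_ofReal (by nlinarith))
    · exact (hN.tsum_gentle_le_of_lt_infDist hMc hM hL hβ4 hβ h).trans
        (ENNReal.ofReal_le_ofReal (by nlinarith))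

end GentleWeight

/-! ### Choice of parameters and conclusion -/

theorem exists_isStrongRandomProjection_of_ballsCoveredBy {X : Type*} [MetricSpace X]
    [SecondCountableTopology X] [MeasurableSpace X] [BorelSpace X] {M : Set X} (hMc : IsClosed M)
    (hM : M.Nonempty) {L : ℕ} (hL : BallsCoveredBy X L) (hL2 : 2 ≤ L) :
    ∃ υ : X → Measure M, IsStrongRandomProjection (3200 * Real.log L) M υ := by
  obtain ⟨N, hN⟩ := exists_isNetFamily M
  have hL2' : (2 : ℝ) ≤ L := by exact_mod_cast hL2
  have hlog : 0.69 ≤ Real.log L := by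
    have := Real.log_le_log two_pos hL2'
    linarith [Real.log_two_gt_d9]
  -- With `β = 16 log L` the left side is `2 / L`; also `β ≥ 8`, because `log L ≥ 0.69`.
  have hβ : Real.exp (-(16 * Real.log L / 8)) * (2 * L) ≤ 1 := by
    rw [show -(16 * Real.log L / 8) = -(Real.log L + Real.log L) by ring, Real.exp_neg,
      Real.exp_add, Real.exp_log (by linarith), inv_mul_le_iff₀ (by positivity)]
    nlinarith
  have h := hN.isGentlePartitionOfUnity hMc hM hL (β := 16 * Real.log L) (by linarith) hβ
  rw [show 200 * (16 * Real.log L) = 3200 * Real.log L by ring] at h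
  let : MeasurableSpace (Σ n, N n) := ⊤
  exact ⟨_, h.isStrongRandomProjection (by linarith)⟩

/-- The claim `C log λ(X) ≥ 1` is the field `one_le` of the projection. The infimum defining `λ(X)`
is attained, so `L = λ(X)` is admissible. -/
theorem mainTheorem4 :
    (∀ (X : Type*) [MetricSpace X] [PolishSpace X] [MeasurableSpace X] [BorelSpace X]
      (M : Set X), IsClosed M →
      ∀ (Ω : Type*) [MeasurableSpace Ω] (P : Measure Ω) (K : ℝ), 1 ≤ K →
      ∀ (Ψ : Ω → X → ℝ) (γ : Ω → M), IsGentlePartitionOfUnity P K M Ψ γ →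
        IsStrongRandomProjection K M (inducedMeasure P M Ψ γ)) ∧
    (∃ C : ℝ, 0 < C ∧
      ∀ (X : Type*) [MetricSpace X] [PolishSpace X] [MeasurableSpace X] [BorelSpace X]
        [Nontrivial X], doublingConstant X < ⊤ →
      ∀ M : Set X, IsClosed M → M.Nonempty →
        ∃ υ : X → Measure M,
          IsStrongRandomProjection (C * Real.log ((doublingConstant X).toNat : ℝ)) M υ) := by
  refine ⟨fun X _ _ _ _ M _ Ω _ P K hK Ψ γ h => h.isStrongRandomProjection hK, 3200, by norm_num,
    fun X _ _ _ _ _ hX M hMc hM => ?_⟩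
  have hL := ballsCoveredBy_toNat_doublingConstant hX
  exact exists_isStrongRandomProjection_of_ballsCoveredBy hMc hM hL hL.two_le
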